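/- Let $E$ be a real affine space of finite dimension $n$, with direction $\vec E$. Yao--Yao partitions of an affine space and their centers are defined by induction on the dimension. If $E=\{x\}$ has dimension $0$, the only Yao--Yao partition of $E$ is $\{\{x\}\}$, with center $x$. If $\dim E\ge 1$, a family $\mathcal P$ of subsets of $E$ is a Yao--Yao partition of $E$ with center $x$ if there are an affine hyperplane $F$ of $E$, a vector $v\in\vec E\setminus\vec F$ and two Yao--Yao partitions $\mathcal P_1,\mathcal P_{-1}$ of $F$ with the same center $x$ such that $$\mathcal P=\{A+\mathbb R_-v : A\in\mathcal P_{-1}\}\cup\{A+\mathbb R_+v : A\in\mathcal P_1\}.$$ A system of coordinates on $E$ is a family $(\ell_1,\dots,\ell_n)$ of affine forms on $E$ such that the map $x\mapsto(\ell_1(x),\dots,\ell_n(x))$ from $E$ to $\mathbb R^n$ is one-to-one. A Yao--Yao partition given by $F,v,x,\mathcal P_1,\mathcal P_{-1}$ is adapted to $(\ell_1,\dots,\ell_n)$ if $F=\{y\in E:\ell_1(y)=\ell_1(x)\}$ and, recursively, $\mathcal P_1$ and $\mathcal P_{-1}$ are adapted to the system of coordinates $(\ell_2|_F,\dots,\ell_n|_F)$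 on $F$; in dimension $0$ there is no condition. Let $\mathcal M^*(E)$ be the set of finite non-negative Borel measures $\mu$ on $E$ such that $\mu(F)=0$ for every affine hyperplane $F$ of $E$ and $\mu(U)>0$ for every nonempty open set $U\subset E$. A center of $\mu$ with respect to $(\ell_1,\dots,\ell_n)$ is a point $x\in E$ that is the center of a Yao--Yao partition $\mathcal P$ of $E$ adapted to $(\ell_1,\dots,\ell_n)$ with $\mu(A)=2^{-n}\mu(E)$ for all $A\in\mathcal P$. **Proposition.** Let $(\ell_1,\dots,\ell_n)$ be a system of coordinates on $E$. Every $\mu\in\mathcal M^*(E)$ has exactly one center with respect to $(\ell_1,\dots,\ell_n)$. -/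

import Mathlib

open MeasureTheory Module

/-!
All affine subspaces and all subsets live in one fixed ambient finite-dimensional real affine
space `P` with direction `V`. A partition of an affine subspace `S` of `P` is a set of subsets
of `P`, and an affine form on `S` is the restriction of an affine form on `P`.
-/

section YaoYao

variable {V P : Type*} [NormedAddCommGroup V] [NormedSpace ℝ V] [MetricSpace P]
  [NormedAddTorsor V P]

/-- `F` is an affine hyperplane of the affine space `S`: a (nonempty) affine subspace of `S` of
codimension one. -/
structure IsAffineHyperplane (F S : AffineSubspace ℝ P) : Prop where
  le : F ≤ S
  nonempty : (F : Set P).Nonempty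
  finrank_add_one : finrank ℝ F.direction + 1 = finrank ℝ S.direction

/-- The set `A + I v = {a + t v | a ∈ A, t ∈ I}`, for `I` a set of reals. -/
def addRay (I : Set ℝ) (A : Set P) (v : V) : Set P :=
  {y | ∃ a ∈ A, ∃ t ∈ I, y = (t • v) +ᵥ a}

/-- The family `{A + ℝ₋ v | A ∈ 𝒫₋₁} ∪ {A + ℝ₊ v | A ∈ 𝒫₁}`. -/
def glueAlong (v : V) (PPneg PPpos : Set (Set P)) : Set (Set P) :=
  {B | ∃ A ∈ PPneg, B = addRay (Set.Iic 0) A v} ∪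
    {B | ∃ A ∈ PPpos, B = addRay (Set.Ici 0) A v}

/-- `IsYaoYaoPartition S PP x`: the family `PP` is a Yao-Yao partition of the affine space `S`,
with center `x`. -/
inductive IsYaoYaoPartition : AffineSubspace ℝ P → Set (Set P) → P → Prop
  | point (S : AffineSubspace ℝ P) (x : P) (hS : (S : Set P) = {x}) :
      IsYaoYaoPartition S {{x}} x
  | step (S F : AffineSubspace ℝ P) (v : V) (PPneg PPpos : Set (Set P)) (x : P)
      (hF : IsAffineHyperplane F S) (hvS : v ∈ S.direction) (hvF : v ∉ F.direction)
      (hneg : IsYaoYaoPartition F PPneg x) (hpos : IsYaoYaoPartition F PPpos x) :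
      IsYaoYaoPartition S (glueAlong v PPneg PPpos) x

/-- `ℓ₁, …, ℓₙ` is a system of coordinates on the (`n`-dimensional) affine space `P`. -/
def IsCoordinateSystem {n : ℕ} (l : Fin n → (P →ᵃ[ℝ] ℝ)) : Prop :=
  finrank ℝ V = n ∧ Function.Injective (fun (x : P) (i : Fin n) => l i x)

/-- `IsAdaptedYaoYaoPartition n l S PP x`: the family `PP` is a Yao-Yao partition of `S` with
center `x`, adapted to the restrictions of `l 0, …, l (n - 1)` to `S`. The hyperplane is
`F = {y ∈ S | l 0 y = l 0 x}`, and the two partitions of `F` are adapted to the restrictions of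
the remaining forms. -/
def IsAdaptedYaoYaoPartition : (n : ℕ) → (Fin n → (P →ᵃ[ℝ] ℝ)) →
    AffineSubspace ℝ P → Set (Set P) → P → Prop
  | 0, _, S, PP, x => (S : Set P) = {x} ∧ PP = {{x}}
  | n + 1, l, S, PP, x =>
      ∃ (F : AffineSubspace ℝ P) (v : V) (PPneg PPpos : Set (Set P)),
        IsAffineHyperplane F S ∧ (F : Set P) = {y | y ∈ S ∧ l 0 y = l 0 x} ∧
        v ∈ S.direction ∧ v ∉ F.direction ∧
        IsAdaptedYaoYaoPartition n (fun i => l i.succ) F PPneg x ∧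
        IsAdaptedYaoYaoPartition n (fun i => l i.succ) F PPpos x ∧
        PP = glueAlong v PPneg PPpos

theorem IsAdaptedYaoYaoPartition.isYaoYaoPartition {n : ℕ} {l : Fin n → (P →ᵃ[ℝ] ℝ)}
    {S : AffineSubspace ℝ P} {PP : Set (Set P)} {x : P}
    (h : IsAdaptedYaoYaoPartition n l S PP x) : IsYaoYaoPartition S PP x := by
  induction n generalizing S PP with
  | zero =>
    obtain ⟨hS, rfl⟩ := h
    exact IsYaoYaoPartition.point S x hS
  | succ n ih =>
    obtain ⟨F, v, PPneg, PPpos, hF, -, hvS, hvF, hneg, hpos, rfl⟩ := h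
    exact IsYaoYaoPartition.step S F v PPneg PPpos x hF hvS hvF (ih hneg) (ih hpos)

variable [MeasurableSpace P]

/-- `PP` is a Yao-Yao equipartition of the whole space for `μ`, with center `x`. -/
structure IsYaoYaoEquipartition (μ : Measure P) (PP : Set (Set P)) (x : P) : Prop where
  isYaoYaoPartition : IsYaoYaoPartition (⊤ : AffineSubspace ℝ P) PP x
  measure_eq : ∀ A ∈ PP, μ A = ((2 : ENNReal) ^ finrank ℝ V)⁻¹ * μ Set.univ

/-- `x` is a (Yao-Yao) center of `μ` with respect to the coordinates `l`: the center of a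
Yao-Yao equipartition for `μ` adapted to `l`. -/
def IsYaoYaoCenter {n : ℕ} (l : Fin n → (P →ᵃ[ℝ] ℝ)) (μ : Measure P) (x : P) : Prop :=
  ∃ PP : Set (Set P), IsAdaptedYaoYaoPartition n l ⊤ PP x ∧ IsYaoYaoEquipartition μ PP x

/-- The class `M(E)`: finite Borel measures that vanish on every affine hyperplane. -/
structure MemM (μ : Measure P) : Prop where
  isFiniteMeasure : IsFiniteMeasure μ
  measure_hyperplane : ∀ F : AffineSubspace ℝ P, IsAffineHyperplane F ⊤ → μ (F : Set P) = 0

/-- The class `M*(E)`: the elements of `M(E)` that charge every nonempty open set. -/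
structure MemMStar (μ : Measure P) : Prop extends MemM μ where
  measure_open_pos : ∀ U : Set P, IsOpen U → U.Nonempty → 0 < μ U

end YaoYao

/-!
The measures of the cells force each cutting hyperplane to bisect its part of the measure, so the
first coordinate of a center is a median of `μ`. The idea is to determine the remaining coordinates
one after the other, which replaces a fixed point argument by the intermediate value theorem.

Projecting along `v` onto the hyperplane `F = {ℓ₁ = ℓ₁(x)}` amounts to keeping the measure where it
is and replacing each form `ℓᵢ`, `i ≥ 2`, by the sheared form `ℓᵢ - wᵢ (ℓ₁ - ℓ₁(x))` that is constant
along `v`. Iterating, a Yao-Yao equipartition becomes a binary tree of cuts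
(`exists_adapted_iff_exists_isTree`). All choices concerning the first `k` coordinates involve only
the first `k` forms, so the last coordinate can be separated (`SplitTree.isTree_succ_iff`): given the
tree for the first `k` forms, slopes at its inner nodes have to be found such that the sheared form
`ℓₖ₊₁` has one and the same median on all cells.

At an inner node with cutting form `s`, replacing `h` by `h - a s` lowers `h` on the side `0 < s` and
raises it on the side `s < 0` as `a` grows. The common medians of the two subtrees are therefore
monotone in opposite directions, and they agree for exactly one slope. Consequently the common median
at the node exists, is unique, strictly increasing in `h` (`SplitTree.Heavy.add`), continuous
(`SplitTree.isOpen_heavy`) and takes either sign for large shears (`SplitTree.eventually_heavy`),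
which are the properties that the next node above requires. At a leaf they hold because `μ` charges
open sets and does not charge hyperplanes.
-/

section SplitTree

open Set Filter Topology

/-! ### Trees of cuts -/

/-- A binary tree of successive cuts of an affine space. A leaf carries the cell that it stands
for, and an inner node carries the affine form `s` whose zero set makes the cut; the first subtree
lies on the side `0 < s` and the second one on the side `s < 0`. -/
inductive SplitTree (V P : Type*) [NormedAddCommGroup V] [NormedSpace ℝ V] [MetricSpace P]
    [NormedAddTorsor V P]
  | leaf (U : Set P) : SplitTree V P
  | node (s : P →ᵃ[ℝ] ℝ) (A B : SplitTree V P) : SplitTree V P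

namespace SplitTree

section Cuts

variable {V P : Type*} [NormedAddCommGroup V] [NormedSpace ℝ V] [MetricSpace P]
  [NormedAddTorsor V P]

/-- The property `p` holds for the cell at every leaf. -/
def Leaves (p : Set P → Prop) : SplitTree V P → Prop
  | leaf U => p U
  | node _ A B => A.Leaves p ∧ B.Leaves p

/-- The affine form `u` is positive on the cell at every leaf. -/
def PosOn (u : P →ᵃ[ℝ] ℝ) (T : SplitTree V P) : Prop :=
  T.Leaves fun U => ∀ x ∈ U, 0 < u x

/-- The tree is compatible with the directions in `E`: the cells are nonempty, open and invariant
under translations along `E`, the cutting forms are constant along `E`, and each cell lies on the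
prescribed side of the cuts above it. -/
def Valid (E : Set V) : SplitTree V P → Prop
  | leaf U => IsOpen U ∧ U.Nonempty ∧ ∀ e ∈ E, ∀ t : ℝ, ∀ x ∈ U, t • e +ᵥ x ∈ U
  | node s A B => (∀ e ∈ E, s.linear e = 0) ∧ A.PosOn s ∧ B.PosOn (-s) ∧ A.Valid E ∧ B.Valid E

theorem Leaves.mono {p q : Set P → Prop} (hpq : ∀ U, p U → q U) {T : SplitTree V P}
    (h : T.Leaves p) : T.Leaves q := by
  induction T with
  | leaf U => exact hpq U h
  | node s A B ihA ihB => exact ⟨ihA h.1, ihB h.2⟩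

theorem PosOn.smul {u : P →ᵃ[ℝ] ℝ} {T : SplitTree V P} (hu : T.PosOn u) {a : ℝ} (ha : 0 < a) :
    T.PosOn (a • u) :=
  Leaves.mono (fun _ h x hx => by simpa using mul_pos ha (h x hx)) hu

theorem posOn_const {a : ℝ} (ha : 0 < a) (T : SplitTree V P) :
    T.PosOn (AffineMap.const ℝ P a) := by
  induction T with
  | leaf U => exact fun x _ => ha
  | node s A B ihA ihB => exact ⟨ihA, ihB⟩

/-- An affine form that is not constant along `e` takes every value on an `e`-invariant set. -/
theorem exists_mem_eq {U : Set P} (hU : U.Nonempty) {e : V}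
    (hinv : ∀ t : ℝ, ∀ x ∈ U, t • e +ᵥ x ∈ U) {h : P →ᵃ[ℝ] ℝ} (he : h.linear e ≠ 0) (c : ℝ) :
    ∃ x ∈ U, h x = c := by
  obtain ⟨x, hx⟩ := hU
  refine ⟨_, hinv ((c - h x) / h.linear e) x hx, ?_⟩
  simp [AffineMap.map_vadd, div_mul_cancel₀ _ he]

theorem linear_add_smul_ne_zero {h u : P →ᵃ[ℝ] ℝ} {e : V} (he : h.linear e ≠ 0)
    (hu : u.linear e = 0) (a : ℝ) : (h + a • u).linear ≠ 0 := fun h0 => he <| by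
  simpa [hu] using congrArg (fun f : V →ₗ[ℝ] ℝ => f e) h0

theorem continuous_form [FiniteDimensional ℝ V] (h : P →ᵃ[ℝ] ℝ) : Continuous h :=
  h.continuous_of_finiteDimensional

variable [MeasurableSpace P] (μ : Measure P)

/-- For suitable slopes of the shears at the inner nodes, the sheared form has median `0` on each
cell. -/
def Balanced : SplitTree V P → (P →ᵃ[ℝ] ℝ) → Prop
  | leaf U, h => μ (U ∩ {x | h x < 0}) = μ (U ∩ {x | 0 < h x})
  | node s A B, h => ∃ a : ℝ, A.Balanced (h - a • s) ∧ B.Balanced (h - a • s)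

/-- For suitable slopes of the shears at the inner nodes, the sheared form has positive median on
each cell. -/
def Heavy : SplitTree V P → (P →ᵃ[ℝ] ℝ) → Prop
  | leaf U, h => μ (U ∩ {x | h x < 0}) < μ (U ∩ {x | 0 < h x})
  | node s A B, h => ∃ a : ℝ, A.Heavy (h - a • s) ∧ B.Heavy (h - a • s)

variable {μ}

theorem balanced_neg {T : SplitTree V P} {h : P →ᵃ[ℝ] ℝ} (hb : T.Balanced μ h) :
    T.Balanced μ (-h) := by
  induction T generalizing h with
  | leaf U => simpa [Balanced] using Eq.symm hb
  | node s A B ihA ihB =>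
    obtain ⟨a, h1, h2⟩ := hb
    refine ⟨-a, ?_, ?_⟩
    · convert ihA h1 using 1; module
    · convert ihB h2 using 1; module

variable [FiniteDimensional ℝ V]

theorem measure_zeroSet (hμ : MemM μ) {h : P →ᵃ[ℝ] ℝ} (hh : h.linear ≠ 0) :
    μ {x | h x = 0} = 0 := by
  rcases Set.eq_empty_or_nonempty {x | h x = 0} with h0 | ⟨x, hx⟩
  · simp [h0]
  have hF : ((AffineSubspace.mk' x (LinearMap.ker h.linear) : AffineSubspace ℝ P) : Set P)
      = {x | h x = 0} := by
    ext y
    have hx' : h x = 0 := hx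
    have : h.linear (y -ᵥ x) = h y := by rw [AffineMap.linearMap_vsub, hx']; simp
    simp [AffineSubspace.mem_mk', this]
  rw [← hF]
  refine hμ.measure_hyperplane _ ⟨le_top, ?_, ?_⟩
  · exact ⟨x, AffineSubspace.self_mem_mk' _ _⟩
  · rw [AffineSubspace.direction_mk', AffineSubspace.direction_top, finrank_top]
    exact Module.Dual.finrank_ker_add_one_of_ne_zero hh

theorem ae_ne_zero (hμ : MemM μ) {h : P →ᵃ[ℝ] ℝ} (hh : h.linear ≠ 0) : ∀ᵐ x ∂μ, h x ≠ 0 := by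
  simpa [ae_iff] using measure_zeroSet hμ hh

variable [BorelSpace P]

theorem measurableSet_neg (h : P →ᵃ[ℝ] ℝ) : MeasurableSet {x | h x < 0} :=
  (isOpen_lt (continuous_form h) continuous_const).measurableSet

theorem measurableSet_pos (h : P →ᵃ[ℝ] ℝ) : MeasurableSet {x | 0 < h x} :=
  (isOpen_lt continuous_const (continuous_form h)).measurableSet

/-- Dominated convergence; no mass is lost at the boundary because hyperplanes are null sets. -/
theorem continuous_measure_neg (hμ : MemM μ) {U : Set P} (hU : MeasurableSet U)
    {h u : P →ᵃ[ℝ] ℝ} (hh : ∀ a : ℝ, (h + a • u).linear ≠ 0) :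
    Continuous fun a : ℝ => μ (U ∩ {x | (h + a • u) x < 0}) := by
  have := hμ.isFiniteMeasure
  refine continuous_iff_continuousAt.2 fun a₀ => ?_
  refine tendsto_measure_of_ae_tendsto_indicator (𝓝 a₀)
    (hU.inter (measurableSet_neg _)) (fun a => hU.inter (measurableSet_neg _))
    MeasurableSet.univ (measure_ne_top _ _) (Eventually.of_forall fun _ => subset_univ _) ?_
  filter_upwards [ae_ne_zero hμ (hh a₀)] with x hx
  have hc : Continuous fun a : ℝ => (h + a • u) x := by
    simp only [AffineMap.coe_add, AffineMap.coe_smul, Pi.add_apply, Pi.smul_apply]; fun_prop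
  rcases lt_or_gt_of_ne hx with hx | hx
  · filter_upwards [hc.continuousAt.eventually (gt_mem_nhds hx)] with a ha
    simp only [mem_inter_iff, mem_ofPred_eq, iff_true_intro ha, iff_true_intro hx]
  · filter_upwards [hc.continuousAt.eventually (lt_mem_nhds hx)] with a ha
    simp only [mem_inter_iff, mem_ofPred_eq, not_lt_of_gt ha, not_lt_of_gt hx]

/-! ### The median of a form on a tree -/

section Median

variable {E : Set V} {e : V} {T : SplitTree V P} {h u : P →ᵃ[ℝ] ℝ}

/-- The median depends continuously on the form, expressed for its sign. -/
theorem isOpen_heavy (hμ : MemM μ) (hT : T.Valid E) (heE : e ∈ E) (he : h.linear e ≠ 0)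
    (hu : u.linear e = 0) : IsOpen {a : ℝ | T.Heavy μ (h + a • u)} := by
  induction T generalizing h with
  | leaf U =>
    refine isOpen_lt (continuous_measure_neg hμ hT.1.measurableSet
      (linear_add_smul_ne_zero he hu)) ?_
    have := continuous_measure_neg hμ hT.1.measurableSet (h := -h) (u := -u)
      (linear_add_smul_ne_zero (e := e) (by simpa using he) (by simpa using hu))
    refine this.congr fun a => ?_
    congr 2
    ext x
    have : (-h + a • -u) x = -((h + a • u) x) := by
      have : -h + a • -u = -(h + a • u) := by module
      rw [this]; rfl
    simp only [mem_ofPred_eq, this, neg_lt_zero]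
  | node s A B ihA ihB =>
    obtain ⟨hs, -, -, hA, hB⟩ := hT
    have : {a : ℝ | (node s A B).Heavy μ (h + a • u)} =
        ⋃ b : ℝ, {a : ℝ | A.Heavy μ (h - b • s + a • u)} ∩
          {a : ℝ | B.Heavy μ (h - b • s + a • u)} := by
      ext a
      simp only [mem_ofPred_eq, Heavy, mem_iUnion, mem_inter_iff, sub_add_eq_add_sub]
    rw [this]
    have hb : ∀ b : ℝ, (h - b • s).linear e ≠ 0 := fun b => by simpa [hs e heE] using he
    exact isOpen_iUnion fun b => (ihA hA (hb b)).inter (ihB hB (hb b))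

/-- The median is strictly increasing. At an inner node the slope for `h` also serves for `h + u`;
at a leaf the measure charges the open set where the sign changes. -/
theorem Heavy.add (hμ : MemMStar μ) (hT : T.Valid E) (heE : e ∈ E) (he : h.linear e ≠ 0)
    (hpos : T.PosOn u) (hh : T.Heavy μ h ∨ T.Balanced μ h) : T.Heavy μ (h + u) := by
  have := hμ.isFiniteMeasure
  induction T generalizing h with
  | leaf U =>
    obtain ⟨hUo, hUn, hinv⟩ := hT
    have hle : μ (U ∩ {x | h x < 0}) ≤ μ (U ∩ {x | 0 < h x}) := hh.elim le_of_lt le_of_eq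
    have h1 : μ (U ∩ {x | (h + u) x < 0}) ≤ μ (U ∩ {x | h x < 0}) := by
      refine measure_mono fun x hx => ⟨hx.1, ?_⟩
      have h2 := hx.2
      have := hpos x hx.1
      simp only [mem_ofPred_eq, AffineMap.coe_add, Pi.add_apply] at h2 ⊢
      linarith
    refine (h1.trans hle).trans_lt ?_
    -- The gain contains the nonempty open set `U ∩ {h < 0 < h + u}`, to which a point
    -- slightly below the zero set of `h` belongs.
    have hO : IsOpen (U ∩ ({x | h x < 0} ∩ {x | 0 < (h + u) x})) :=
      hUo.inter ((isOpen_lt (continuous_form h) continuous_const).inter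
        (isOpen_lt continuous_const (continuous_form (h + u))))
    have hne : (U ∩ ({x | h x < 0} ∩ {x | 0 < (h + u) x})).Nonempty := by
      obtain ⟨x, hx, hx0⟩ := exists_mem_eq hUn (hinv e heE) he 0
      have hopen : IsOpen (U ∩ {x | 0 < (h + u) x}) :=
        hUo.inter (isOpen_lt continuous_const (continuous_form (h + u)))
      have hxm : x ∈ U ∩ {x | 0 < (h + u) x} := ⟨hx, by simpa [hx0] using hpos x hx⟩
      have hc : Continuous fun t : ℝ => (-(t / h.linear e)) • e +ᵥ x := by fun_prop
      have hev : ∀ᶠ t in 𝓝 (0 : ℝ),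
          (-(t / h.linear e)) • e +ᵥ x ∈ U ∩ {x | 0 < (h + u) x} := by
        refine hc.continuousAt.eventually_mem (hopen.mem_nhds ?_)
        simpa only [zero_div, neg_zero, zero_smul, zero_vadd] using hxm
      obtain ⟨t, ht, ht0⟩ := ((hev.filter_mono nhdsWithin_le_nhds).and
        (self_mem_nhdsWithin (s := Ioi (0 : ℝ)))).exists
      refine ⟨_, ht.1, ?_, ht.2⟩
      have ht0 : 0 < t := ht0
      simp [AffineMap.map_vadd, hx0, div_mul_cancel₀ _ he, ht0]
    have hdisj : Disjoint (U ∩ {x | 0 < h x}) (U ∩ ({x | h x < 0} ∩ {x | 0 < (h + u) x})) :=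
      by
      refine Set.disjoint_left.2 fun x h1 h2 => ?_
      have h3 : 0 < h x := h1.2
      exact lt_asymm h3 h2.2.1
    calc μ (U ∩ {x | 0 < h x})
        < μ (U ∩ {x | 0 < h x}) + μ (U ∩ ({x | h x < 0} ∩ {x | 0 < (h + u) x})) :=
          ENNReal.lt_add_right (measure_ne_top _ _) (hμ.measure_open_pos _ hO hne).ne'
      _ = μ ((U ∩ {x | 0 < h x}) ∪ (U ∩ ({x | h x < 0} ∩ {x | 0 < (h + u) x}))) :=
          (measure_union hdisj hO.measurableSet).symm
      _ ≤ μ (U ∩ {x | 0 < (h + u) x}) := by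
          refine measure_mono (union_subset (fun x hx => ⟨hx.1, ?_⟩) fun x hx => ⟨hx.1, hx.2.2⟩)
          have h2 := hx.2
          have := hpos x hx.1
          simp only [mem_ofPred_eq, AffineMap.coe_add, Pi.add_apply] at h2 ⊢
          linarith
  | node s A B ihA ihB =>
    obtain ⟨hs, -, -, hA, hB⟩ := hT
    have hb : ∀ b : ℝ, (h - b • s).linear e ≠ 0 := fun b => by simpa [hs e heE] using he
    have key : ∀ a : ℝ, h + u - a • s = h - a • s + u := fun a => by module
    rcases hh with ⟨a, h1, h2⟩ | ⟨a, h1, h2⟩ <;> refine ⟨a, ?_, ?_⟩ <;> rw [key]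
    · exact ihA hA (hb a) hpos.1 (Or.inl h1)
    · exact ihB hB (hb a) hpos.2 (Or.inl h2)
    · exact ihA hA (hb a) hpos.1 (Or.inr h1)
    · exact ihB hB (hb a) hpos.2 (Or.inr h2)

/-- The sign of the median is unambiguous, although `Heavy` and `Balanced` only ask that some slopes
exist. -/
theorem not_heavy_neg (hμ : MemMStar μ) (hT : T.Valid E) (heE : e ∈ E) (he : h.linear e ≠ 0)
    (hh : T.Heavy μ h ∨ T.Balanced μ h) : ¬ T.Heavy μ (-h) := by
  induction T generalizing h with
  | leaf U =>
    have hle : μ (U ∩ {x | h x < 0}) ≤ μ (U ∩ {x | 0 < h x}) := hh.elim le_of_lt le_of_eq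
    simpa [Heavy] using hle
  | node s A B ihA ihB =>
    obtain ⟨hs, hsA, hsB, hA, hB⟩ := hT
    have hb : ∀ b : ℝ, (h - b • s).linear e ≠ 0 := fun b => by simpa [hs e heE] using he
    have hh' : ∃ a : ℝ, (A.Heavy μ (h - a • s) ∨ A.Balanced μ (h - a • s)) ∧
        (B.Heavy μ (h - a • s) ∨ B.Balanced μ (h - a • s)) := by
      rcases hh with ⟨a, h1, h2⟩ | ⟨a, h1, h2⟩
      exacts [⟨a, Or.inl h1, Or.inl h2⟩, ⟨a, Or.inr h1, Or.inr h2⟩]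
    obtain ⟨a, h1, h2⟩ := hh'
    rintro ⟨b, h3, h4⟩
    have hbe : -h - b • s = -(h - (-b) • s) := by module
    rw [hbe] at h3 h4
    -- A change of slope raises the form on one of the two sides.
    rcases lt_trichotomy a (-b) with hlt | heq | hlt
    · refine ihB hB (hb (-b)) (Or.inl ?_) h4
      have : h - (-b) • s = h - a • s + (-b - a) • (-s) := by module
      rw [this]
      exact Heavy.add hμ hB heE (hb a) (hsB.smul (sub_pos.2 hlt)) h2
    · subst heq; exact ihA hA (hb _) h1 h3
    · refine ihA hA (hb (-b)) (Or.inl ?_) h3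
      have : h - (-b) • s = h - a • s + (a - (-b)) • s := by module
      rw [this]
      exact Heavy.add hμ hA heE (hb a) (hsA.smul (sub_pos.2 hlt)) h1

theorem eventually_heavy (hμ : MemMStar μ) (hT : T.Valid E) (hpos : T.PosOn u) :
    ∀ᶠ a : ℝ in atTop, T.Heavy μ (h + a • u) := by
  have := hμ.isFiniteMeasure
  induction T generalizing h with
  | leaf U =>
    have hm := hT.1.measurableSet
    have hlim : ∀ x ∈ U, ∀ᶠ a : ℝ in atTop, 0 < (h + a • u) x := fun x hx => by
      have : Tendsto (fun a : ℝ => h x + a * u x) atTop atTop :=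
        tendsto_atTop_add_const_left _ _ (tendsto_id.atTop_mul_const (hpos x hx))
      filter_upwards [this.eventually_gt_atTop 0] with a ha
      simpa using ha
    have h1 : Tendsto (fun a : ℝ => μ (U ∩ {x | (h + a • u) x < 0})) atTop (𝓝 (μ ∅)) := by
      refine tendsto_measure_of_ae_tendsto_indicator atTop MeasurableSet.empty
        (fun a => hm.inter (measurableSet_neg _)) MeasurableSet.univ
        (measure_ne_top _ _) (Eventually.of_forall fun _ => subset_univ _)
        (Eventually.of_forall fun x => ?_)
      by_cases hx : x ∈ U
      · filter_upwards [hlim x hx] with a ha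
        simp only [mem_inter_iff, mem_ofPred_eq, not_lt_of_gt ha, and_false, mem_empty_iff_false]
      · exact Eventually.of_forall fun a => by simp [hx]
    have h2 : Tendsto (fun a : ℝ => μ (U ∩ {x | 0 < (h + a • u) x})) atTop (𝓝 (μ U)) := by
      refine tendsto_measure_of_ae_tendsto_indicator atTop hm
        (fun a => hm.inter (measurableSet_pos _)) MeasurableSet.univ
        (measure_ne_top _ _) (Eventually.of_forall fun _ => subset_univ _)
        (Eventually.of_forall fun x => ?_)
      by_cases hx : x ∈ U
      · filter_upwards [hlim x hx] with a ha
        simp only [mem_inter_iff, mem_ofPred_eq, iff_true_intro ha, and_true]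
      · exact Eventually.of_forall fun a => by simp [hx]
    exact h1.eventually_lt h2 (by simpa using hμ.measure_open_pos U hT.1 hT.2.1)
  | node s A B ihA ihB =>
    obtain ⟨-, -, -, hA, hB⟩ := hT
    filter_upwards [ihA hA hpos.1, ihB hB hpos.2] with a h1 h2
    exact ⟨0, by simpa using h1, by simpa using h2⟩

theorem balanced_slope_unique (hμ : MemMStar μ) (hT : T.Valid E) (heE : e ∈ E)
    (he : h.linear e ≠ 0) (hu : u.linear e = 0) (hpos : T.PosOn u) {a b : ℝ}
    (ha : T.Balanced μ (h - a • u)) (hb : T.Balanced μ (h - b • u)) : a = b := by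
  wlog hab : b < a generalizing a b
  · rcases lt_trichotomy a b with hlt | heq | hlt
    exacts [(this hb ha hlt).symm, heq, this ha hb hlt]
  have hbe : ∀ b : ℝ, (h - b • u).linear e ≠ 0 := fun b => by simpa [hu] using he
  have h1 := Heavy.add hμ hT heE (hbe a) (hpos.smul (sub_pos.2 hab)) (Or.inr ha)
  have h2 : h - a • u + (a - b) • u = - -(h - b • u) := by module
  rw [h2] at h1
  exact absurd h1 (not_heavy_neg hμ hT heE (by simpa [hu] using he) (Or.inr (balanced_neg hb)))

/-- The intermediate value argument: the two open sets of slopes on which the median is positive,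
respectively negative, are disjoint and nonempty, hence do not cover the line. -/
theorem exists_balanced_of_trichotomy (hμ : MemMStar μ) (hT : T.Valid E) (heE : e ∈ E)
    (he : h.linear e ≠ 0) (hu : u.linear e = 0) (hpos : T.PosOn u)
    (htri : ∀ a : ℝ, T.Heavy μ (h - a • u) ∨ T.Balanced μ (h - a • u) ∨
      T.Heavy μ (-(h - a • u))) : ∃ a : ℝ, T.Balanced μ (h - a • u) := by
  by_contra! hno
  have hbe : ∀ b : ℝ, (h - b • u).linear e ≠ 0 := fun b => by simpa [hu] using he
  have h1 : IsOpen {a : ℝ | T.Heavy μ (h - a • u)} := by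
    have := isOpen_heavy hμ.toMemM hT heE he (u := -u) (by simpa using hu)
    simpa [sub_eq_add_neg] using this
  have h2 : IsOpen {a : ℝ | T.Heavy μ (-(h - a • u))} := by
    have := isOpen_heavy hμ.toMemM hT heE (h := -h) (by simpa using he) hu
    simpa [sub_eq_add_neg, add_comm] using this
  have hn1 : ∃ a : ℝ, T.Heavy μ (h - a • u) := by
    obtain ⟨a, ha⟩ := (eventually_heavy (h := h) hμ hT hpos).exists
    exact ⟨-a, by simpa using ha⟩
  have hn2 : ∃ a : ℝ, T.Heavy μ (-(h - a • u)) := by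
    obtain ⟨a, ha⟩ := (eventually_heavy (h := -h) hμ hT hpos).exists
    exact ⟨a, by simpa [sub_eq_add_neg, add_comm] using ha⟩
  obtain ⟨a, -, ha1, ha2⟩ := isPreconnected_univ (α := ℝ) _ _ h1 h2
    (fun a _ => (htri a).imp_right fun h => h.resolve_left (hno a))
    ⟨hn1.choose, mem_univ _, hn1.choose_spec⟩
    ⟨hn2.choose, mem_univ _, hn2.choose_spec⟩
  exact not_heavy_neg hμ hT heE (hbe a) (Or.inl ha1) ha2

theorem trichotomy (hμ : MemMStar μ) (hT : T.Valid E) (heE : e ∈ E) (he : h.linear e ≠ 0) :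
    T.Heavy μ h ∨ T.Balanced μ h ∨ T.Heavy μ (-h) := by
  induction T generalizing h with
  | leaf U => simpa [Heavy, Balanced] using lt_trichotomy (μ (U ∩ {x | h x < 0})) _
  | node s A B ihA ihB =>
    obtain ⟨hs, hsA, hsB, hA, hB⟩ := hT
    have hse := hs e heE
    have hb : ∀ b : ℝ, (h - b • s).linear e ≠ 0 := fun b => by simpa [hse] using he
    have hb' : ∀ b : ℝ, (-(h - b • s)).linear e ≠ 0 := fun b => by simpa [hse] using he
    -- Each side has a slope that balances it; their order decides the sign of the median.
    obtain ⟨a, ha⟩ := exists_balanced_of_trichotomy hμ hA heE he hse hsA fun b => ihA hA (hb b)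
    obtain ⟨b, hbal⟩ := exists_balanced_of_trichotomy hμ hB heE he (u := -s) (by simpa using hse)
      hsB fun b => ihB hB (by simpa [hse] using he)
    have hbal : B.Balanced μ (h - (-b) • s) := by convert hbal using 1; module
    rcases lt_trichotomy (-b) a with hlt | heq | hlt
    · left
      refine ⟨(a - b) / 2, ?_, ?_⟩
      · have : h - ((a - b) / 2) • s = h - a • s + ((a + b) / 2) • s := by module
        rw [this]
        exact Heavy.add hμ hA heE (hb a) (hsA.smul (by linarith)) (Or.inr ha)
      · have : h - ((a - b) / 2) • s = h - (-b) • s + ((a + b) / 2) • (-s) := by module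
        rw [this]
        exact Heavy.add hμ hB heE (hb _) (hsB.smul (by linarith)) (Or.inr hbal)
    · exact Or.inr (Or.inl ⟨a, ha, heq ▸ hbal⟩)
    · right; right
      refine ⟨(b - a) / 2, ?_, ?_⟩
      · have : -h - ((b - a) / 2) • s = -(h - a • s) + (-(a + b) / 2) • s := by module
        rw [this]
        exact Heavy.add hμ hA heE (hb' a) (hsA.smul (by linarith)) (Or.inr (balanced_neg ha))
      · have : -h - ((b - a) / 2) • s = -(h - (-b) • s) + (-(a + b) / 2) • (-s) := by module
        rw [this]
        exact Heavy.add hμ hB heE (hb' _) (hsB.smul (by linarith)) (Or.inr (balanced_neg hbal))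

/-- Subtracting a suitable multiple of a form that is positive on all cells makes the median zero.
The multiplier is unique by `balanced_slope_unique`. -/
theorem exists_balanced (hμ : MemMStar μ) (hT : T.Valid E) (heE : e ∈ E) (he : h.linear e ≠ 0)
    (hu : u.linear e = 0) (hpos : T.PosOn u) : ∃ a : ℝ, T.Balanced μ (h - a • u) :=
  exists_balanced_of_trichotomy hμ hT heE he hu hpos fun a =>
    trichotomy hμ hT heE (by simpa [hu] using he)

end Median

end Cuts

/-! ### Refining a tree by one more coordinate -/

section Refine

variable {V P : Type*} [NormedAddCommGroup V] [NormedSpace ℝ V] [MetricSpace P]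
  [NormedAddTorsor V P] [MeasurableSpace P]

/-- The tree `T'` arises from `T` by bisecting each cell along the zero set of a sheared version of
the form, as in `SplitTree.Balanced`. -/
def Grow (μ : Measure P) : SplitTree V P → (P →ᵃ[ℝ] ℝ) → SplitTree V P → Prop
  | leaf U, h, T' => μ (U ∩ {x | h x < 0}) = μ (U ∩ {x | 0 < h x}) ∧
      T' = node h (leaf (U ∩ {x | 0 < h x})) (leaf (U ∩ {x | h x < 0}))
  | node s A B, h, T' => ∃ (a : ℝ) (A' B' : SplitTree V P), T' = node s A' B' ∧
      A.Grow μ (h - a • s) A' ∧ B.Grow μ (h - a • s) B'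

/-- The tree `T` describes a Yao-Yao equipartition of `U` centered at the common zero of the forms
`X 0, …, X (n - 1)`: the zero set of `X 0` bisects `U`, and both halves are treated recursively with
the remaining forms made constant along a common direction `v`. The vector `v` is encoded by the
numbers `w i = X (i + 1) v / X 0 v`. -/
def IsTree (μ : Measure P) : (n : ℕ) → Set P → (Fin n → (P →ᵃ[ℝ] ℝ)) → SplitTree V P → Prop
  | 0, U, _, T => T = leaf U
  | n + 1, U, X, T => μ (U ∩ {x | X 0 x < 0}) = μ (U ∩ {x | 0 < X 0 x}) ∧
      ∃ (w : Fin n → ℝ) (A B : SplitTree V P), T = node (X 0) A B ∧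
        IsTree μ n (U ∩ {x | 0 < X 0 x}) (fun i => X i.succ - w i • X 0) A ∧
        IsTree μ n (U ∩ {x | X 0 x < 0}) (fun i => X i.succ - w i • X 0) B

variable {μ : Measure P}

theorem balanced_iff_exists_grow {T : SplitTree V P} {h : P →ᵃ[ℝ] ℝ} :
    T.Balanced μ h ↔ ∃ T', T.Grow μ h T' := by
  induction T generalizing h with
  | leaf U => exact ⟨fun hb => ⟨_, hb, rfl⟩, fun ⟨_, hb, _⟩ => hb⟩
  | node s A B ihA ihB =>
    constructor
    · rintro ⟨a, h1, h2⟩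
      obtain ⟨A', hA'⟩ := ihA.1 h1
      obtain ⟨B', hB'⟩ := ihB.1 h2
      exact ⟨_, a, A', B', rfl, hA', hB'⟩
    · rintro ⟨_, a, A', B', -, hA', hB'⟩
      exact ⟨a, ihA.2 ⟨_, hA'⟩, ihB.2 ⟨_, hB'⟩⟩

/-- The last coordinate may be treated after all the others: this turns the recursion on the first
coordinate into a recursion on the last one. -/
theorem isTree_succ_iff {n : ℕ} {U : Set P} {X : Fin (n + 1) → (P →ᵃ[ℝ] ℝ)}
    {T' : SplitTree V P} :
    IsTree μ (n + 1) U X T' ↔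
      ∃ T, IsTree μ n U (fun i => X i.castSucc) T ∧ T.Grow μ (X (Fin.last n)) T' := by
  induction n generalizing U T' with
  | zero =>
    constructor
    · rintro ⟨h0, w, A, B, rfl, rfl, rfl⟩
      exact ⟨_, rfl, h0, rfl⟩
    · rintro ⟨T, rfl, h0, rfl⟩
      exact ⟨h0, Fin.elim0, _, _, rfl, rfl, rfl⟩
  | succ n ih =>
    constructor
    · rintro ⟨h0, w, A', B', rfl, hA', hB'⟩
      obtain ⟨A, hA, hgA⟩ := ih.1 hA'
      obtain ⟨B, hB, hgB⟩ := ih.1 hB'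
      exact ⟨_, ⟨h0, fun i => w i.castSucc, A, B, rfl, hA, hB⟩, w (Fin.last n), A', B', rfl,
        hgA, hgB⟩
    · rintro ⟨T, ⟨h0, w, A, B, rfl, hA, hB⟩, a, A', B', rfl, hgA, hgB⟩
      refine ⟨h0, Fin.snoc w a, A', B', rfl, ih.2 ⟨A, ?_, ?_⟩, ih.2 ⟨B, ?_, ?_⟩⟩
      · simp only [Fin.snoc_castSucc]; exact hA
      · simp only [Fin.snoc_last]; exact hgA
      · simp only [Fin.snoc_castSucc]; exact hB
      · simp only [Fin.snoc_last]; exact hgB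

theorem Grow.leaves {p : Set P → Prop} {T T' : SplitTree V P} {h : P →ᵃ[ℝ] ℝ}
    (hg : T.Grow μ h T') (hp : ∀ U W, W ⊆ U → p U → p W) (hT : T.Leaves p) : T'.Leaves p := by
  induction T generalizing h T' with
  | leaf U =>
    obtain ⟨-, rfl⟩ := hg
    exact ⟨hp _ _ inter_subset_left hT, hp _ _ inter_subset_left hT⟩
  | node s A B ihA ihB =>
    obtain ⟨a, A', B', rfl, hA, hB⟩ := hg
    exact ⟨ihA hA hT.1, ihB hB hT.2⟩

theorem Grow.posOn {T T' : SplitTree V P} {h u : P →ᵃ[ℝ] ℝ} (hg : T.Grow μ h T')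
    (hu : T.PosOn u) : T'.PosOn u :=
  hg.leaves (fun _ _ hWU hU x hx => hU x (hWU hx)) hu

section Valid

variable [FiniteDimensional ℝ V] {E : Set V} {e : V} {T T' T'' : SplitTree V P} {h : P →ᵃ[ℝ] ℝ}

theorem Grow.valid {E' : Set V} (hT : T.Valid E) (heE : e ∈ E) (he : h.linear e ≠ 0)
    (hE' : E' ⊆ E) (hh : ∀ v ∈ E', h.linear v = 0) (hg : T.Grow μ h T') : T'.Valid E' := by
  induction T generalizing h T' with
  | leaf U =>
    obtain ⟨hUo, hUn, hinv⟩ := hT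
    obtain ⟨-, rfl⟩ := hg
    have hinv' : ∀ v ∈ E', ∀ t : ℝ, ∀ x, h (t • v +ᵥ x) = h x := fun v hv t x => by
      simp [AffineMap.map_vadd, hh v hv]
    refine ⟨hh, fun x hx => hx.2, fun x hx => ?_,
      ⟨hUo.inter (isOpen_lt continuous_const (continuous_form h)), ?_, ?_⟩,
      ⟨hUo.inter (isOpen_lt (continuous_form h) continuous_const), ?_, ?_⟩⟩
    · have hx2 : h x < 0 := hx.2
      simpa using hx2
    · obtain ⟨x, hx, hx1⟩ := exists_mem_eq hUn (hinv e heE) he 1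
      exact ⟨x, hx, by simp [hx1]⟩
    · exact fun v hv t x hx => ⟨hinv v (hE' hv) t x hx.1, by simpa [hinv' v hv t x] using hx.2⟩
    · obtain ⟨x, hx, hx1⟩ := exists_mem_eq hUn (hinv e heE) he (-1)
      exact ⟨x, hx, by simp [hx1]⟩
    · exact fun v hv t x hx => ⟨hinv v (hE' hv) t x hx.1, by simpa [hinv' v hv t x] using hx.2⟩
  | node s A B ihA ihB =>
    obtain ⟨hs, hsA, hsB, hA, hB⟩ := hT
    obtain ⟨a, A', B', rfl, hgA, hgB⟩ := hg
    have hb : (h - a • s).linear e ≠ 0 := by simpa [hs e heE] using he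
    have hv : ∀ v ∈ E', (h - a • s).linear v = 0 := fun v hv => by
      simp [hs v (hE' hv), hh v hv]
    exact ⟨fun v hv => hs v (hE' hv), hgA.posOn hsA, hgB.posOn hsB, ihA hA hb hv hgA,
      ihB hB hb hv hgB⟩

variable [BorelSpace P]

theorem Grow.unique (hμ : MemMStar μ) (hT : T.Valid E) (heE : e ∈ E) (he : h.linear e ≠ 0)
    (h1 : T.Grow μ h T') (h2 : T.Grow μ h T'') : T' = T'' := by
  induction T generalizing h T' T'' with
  | leaf U => rw [h1.2, h2.2]
  | node s A B ihA ihB =>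
    obtain ⟨hs, hsA, hsB, hA, hB⟩ := hT
    obtain ⟨a, A', B', rfl, hA1, hB1⟩ := h1
    obtain ⟨b, A'', B'', rfl, hA2, hB2⟩ := h2
    obtain rfl : a = b := balanced_slope_unique hμ hA heE he (hs e heE) hsA
      (balanced_iff_exists_grow.2 ⟨_, hA1⟩) (balanced_iff_exists_grow.2 ⟨_, hA2⟩)
    have hb : (h - a • s).linear e ≠ 0 := by simpa [hs e heE] using he
    rw [ihA hA hb hA1 hA2, ihB hB hb hB1 hB2]

end Valid

variable [FiniteDimensional ℝ V] [BorelSpace P]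

/-- Induction over initial segments of the coordinate system: the next coordinate of the center is
the unique constant whose subtraction balances the next form on the tree built so far. Directions
along which the earlier forms are constant provide the vector needed for `Valid`. -/
theorem exists_unique_isTree (hμ : MemMStar μ) {n : ℕ} (X : Fin n → (P →ᵃ[ℝ] ℝ))
    (hX : ∀ w : Fin n → ℝ, ∃ v : V, ∀ i, (X i).linear v = w i) :
    ∃ (c : Fin n → ℝ) (T : SplitTree V P), T.Valid {v | ∀ i, (X i).linear v = 0} ∧
      IsTree μ n univ (fun i => X i - AffineMap.const ℝ P (c i)) T ∧
      ∀ (c' : Fin n → ℝ) (T' : SplitTree V P),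
        IsTree μ n univ (fun i => X i - AffineMap.const ℝ P (c' i)) T' → c' = c ∧ T' = T := by
  induction n with
  | zero =>
    refine ⟨Fin.elim0, leaf univ, ?_, rfl, fun c' T' h => ⟨Subsingleton.elim _ _, h⟩⟩
    exact ⟨isOpen_univ, ⟨Classical.arbitrary P, mem_univ _⟩, fun _ _ _ _ _ => mem_univ _⟩
  | succ n ih =>
    obtain ⟨c, T, hT, hcT, huniq⟩ := ih (fun i => X i.castSucc) fun w => by
      obtain ⟨v, hv⟩ := hX (Fin.snoc w 0)
      exact ⟨v, fun i => by simpa using hv i.castSucc⟩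
    obtain ⟨e, he⟩ := hX (Fin.snoc 0 1)
    have heE : e ∈ {v : V | ∀ i : Fin n, (X i.castSucc).linear v = 0} := fun i => by
      simpa using he i.castSucc
    have hel : ∀ a : ℝ, (X (Fin.last n) - AffineMap.const ℝ P a).linear e ≠ 0 := fun a => by
      simp [he (Fin.last n)]
    have hsmul : ∀ a : ℝ, X (Fin.last n) - AffineMap.const ℝ P a =
        X (Fin.last n) - a • AffineMap.const ℝ P 1 := fun a => by
      ext x; simp
    have he0 : (X (Fin.last n)).linear e ≠ 0 := by simp [he (Fin.last n)]
    obtain ⟨a, ha⟩ := exists_balanced hμ hT heE he0 (u := AffineMap.const ℝ P 1) (by simp)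
      (posOn_const one_pos T)
    obtain ⟨T', hT'⟩ := balanced_iff_exists_grow.1 ha
    rw [← hsmul] at hT'
    refine ⟨Fin.snoc c a, T', ?_, isTree_succ_iff.2 ⟨T, ?_, ?_⟩, fun c' T'' h => ?_⟩
    · refine Grow.valid hT heE (hel a) (fun v hv i => hv i.castSucc) (fun v hv => ?_) hT'
      simpa using hv (Fin.last n)
    · simpa only [Fin.snoc_castSucc] using hcT
    · simpa only [Fin.snoc_last] using hT'
    · obtain ⟨T₀, hT₀, hg⟩ := isTree_succ_iff.1 h
      obtain ⟨hc, rfl⟩ := huniq (fun i => c' i.castSucc) T₀ hT₀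
      obtain rfl : a = c' (Fin.last n) := balanced_slope_unique hμ hT heE he0
        (u := AffineMap.const ℝ P 1) (by simp) (posOn_const one_pos _) ha
        (by rw [← hsmul]; exact balanced_iff_exists_grow.2 ⟨_, hg⟩)
      refine ⟨?_, Grow.unique hμ hT heE (hel _) hg hT'⟩
      rw [← hc]
      exact (Fin.snoc_init_self c').symm

end Refine

end SplitTree

end SplitTree

section YaoYaoGeometry

open Set SplitTree

/-! ### Coordinates on a subspace and its hyperplanes -/

variable {V P : Type*} [NormedAddCommGroup V] [NormedSpace ℝ V] [MetricSpace P]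
  [NormedAddTorsor V P]

/-- The linear parts of the forms `l i` are coordinates on the direction of `S`. -/
def IsCoordinateSystemOn {n : ℕ} (l : Fin n → (P →ᵃ[ℝ] ℝ)) (S : AffineSubspace ℝ P) : Prop :=
  ∀ w : Fin n → ℝ, ∃! v : V, v ∈ S.direction ∧ ∀ i, (l i).linear v = w i

theorem IsCoordinateSystemOn.finrank_direction {n : ℕ} {l : Fin n → (P →ᵃ[ℝ] ℝ)}
    {S : AffineSubspace ℝ P} (hl : IsCoordinateSystemOn l S) : finrank ℝ S.direction = n := by
  let L : S.direction →ₗ[ℝ] (Fin n → ℝ) :=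
    LinearMap.pi fun i => (l i).linear ∘ₗ S.direction.subtype
  have hL : Function.Bijective L := by
    refine (Function.bijective_iff_existsUnique _).2 fun w => ?_
    obtain ⟨v, ⟨hv, hvw⟩, huniq⟩ := hl w
    exact ⟨⟨v, hv⟩, funext hvw, fun v' hv' =>
      Subtype.ext (huniq v' ⟨v'.2, fun i => congrFun hv' i⟩)⟩
  simpa using (LinearEquiv.ofBijective L hL).finrank_eq

theorem IsCoordinateSystem.isCoordinateSystemOn_top [FiniteDimensional ℝ V] {n : ℕ}
    {l : Fin n → (P →ᵃ[ℝ] ℝ)}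
    (hl : IsCoordinateSystem l) : IsCoordinateSystemOn l ⊤ := by
  obtain ⟨hn, hinj⟩ := hl
  let L : V →ₗ[ℝ] (Fin n → ℝ) := LinearMap.pi fun i => (l i).linear
  have hLi : Function.Injective L := by
    refine (injective_iff_map_eq_zero L).2 fun v hv => ?_
    have hv' : ∀ i, (l i).linear v = 0 := fun i => congrFun hv i
    have x := Classical.arbitrary P
    have : v +ᵥ x = x := hinj (funext fun i => by simp [AffineMap.map_vadd, hv' i])
    exact vadd_right_cancel x (this.trans (zero_vadd V x).symm)
  have hLs : Function.Surjective L :=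
    (LinearMap.injective_iff_surjective_of_finrank_eq_finrank (by simp [hn])).1 hLi
  intro w
  obtain ⟨v, hv⟩ := hLs w
  refine ⟨v, ⟨by simp, fun i => congrFun hv i⟩, fun v' hv' => hLi ?_⟩
  rw [hv]
  exact funext hv'.2

section Hyperplane

variable {S F : AffineSubspace ℝ P} {f : P →ᵃ[ℝ] ℝ} {x : P}

theorem mem_direction_levelSet_iff (hx : x ∈ S)
    (hF : (F : Set P) = {y | y ∈ S ∧ f y = f x}) {v : V} :
    v ∈ F.direction ↔ v ∈ S.direction ∧ f.linear v = 0 := by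
  have hmem : ∀ y, y ∈ F ↔ y ∈ S ∧ f y = f x := fun y => by
    rw [← SetLike.mem_coe, hF, mem_ofPred_eq]
  rw [← AffineSubspace.vadd_mem_iff_mem_direction v ((hmem x).2 ⟨hx, rfl⟩), hmem,
    AffineSubspace.vadd_mem_iff_mem_direction v hx, AffineMap.map_vadd]
  simp

theorem exists_levelSet (S : AffineSubspace ℝ P) (f : P →ᵃ[ℝ] ℝ) (x : P) :
    ∃ F : AffineSubspace ℝ P, (F : Set P) = {y | y ∈ S ∧ f y = f x} := by
  refine ⟨S ⊓ AffineSubspace.mk' x (LinearMap.ker f.linear), ?_⟩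
  ext y
  rw [SetLike.mem_coe, AffineSubspace.mem_inf_iff, AffineSubspace.mem_mk', LinearMap.mem_ker,
    AffineMap.linearMap_vsub, vsub_eq_sub, sub_eq_zero, mem_ofPred_eq]

theorem IsCoordinateSystemOn.tail {n : ℕ} {l : Fin (n + 1) → (P →ᵃ[ℝ] ℝ)}
    (hl : IsCoordinateSystemOn l S) (hx : x ∈ S)
    (hF : (F : Set P) = {y | y ∈ S ∧ l 0 y = l 0 x}) :
    IsCoordinateSystemOn (fun i => l i.succ) F := by
  intro w
  obtain ⟨v, ⟨hv, hvw⟩, huniq⟩ := hl (Fin.cons 0 w)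
  refine ⟨v, ⟨(mem_direction_levelSet_iff hx hF).2 ⟨hv, by simpa using hvw 0⟩, fun i => by
    simpa using hvw i.succ⟩, fun v' ⟨hv', hvw'⟩ => ?_⟩
  rw [mem_direction_levelSet_iff hx hF] at hv'
  refine huniq v' ⟨hv'.1, Fin.cases ?_ fun i => ?_⟩
  · simpa using hv'.2
  · simpa using hvw' i

theorem IsCoordinateSystemOn.isAffineHyperplane {n : ℕ} {l : Fin (n + 1) → (P →ᵃ[ℝ] ℝ)}
    (hl : IsCoordinateSystemOn l S) (hx : x ∈ S)
    (hF : (F : Set P) = {y | y ∈ S ∧ l 0 y = l 0 x}) : IsAffineHyperplane F S := by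
  refine ⟨fun y hy => ?_, ⟨x, ?_⟩, ?_⟩
  · rw [← SetLike.mem_coe, hF] at hy; exact hy.1
  · rw [hF]; exact ⟨hx, rfl⟩
  · rw [hl.finrank_direction, (hl.tail hx hF).finrank_direction]

end Hyperplane

/-! ### Cells of an adapted partition -/

theorem glueAlong_neg (v : V) (PPneg PPpos : Set (Set P)) :
    glueAlong (-v) PPpos PPneg = glueAlong v PPneg PPpos := by
  have h1 : ∀ A : Set P, addRay (Iic 0) A (-v) = addRay (Ici 0) A v := fun A => by
    ext y
    constructor <;> rintro ⟨a, ha, t, ht, rfl⟩ <;>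
      exact ⟨a, ha, -t, by simpa using ht, by simp⟩
  have h2 : ∀ A : Set P, addRay (Ici 0) A (-v) = addRay (Iic 0) A v := fun A => by
    ext y
    constructor <;> rintro ⟨a, ha, t, ht, rfl⟩ <;>
      exact ⟨a, ha, -t, by simpa using ht, by simp⟩
  simp only [glueAlong, h1, h2, union_comm]

/-- A Yao-Yao partition of an `n`-dimensional space consists of at most `2 ^ n` sets, which cover
the space. -/
theorem IsAdaptedYaoYaoPartition.exists_finset {n : ℕ} {l : Fin n → (P →ᵃ[ℝ] ℝ)}
    {S : AffineSubspace ℝ P} {PP : Set (Set P)} {x : P} (hx : x ∈ S)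
    (h : IsAdaptedYaoYaoPartition n l S PP x) :
    ∃ s : Finset (Set P), (s : Set (Set P)) = PP ∧ s.card ≤ 2 ^ n ∧
      (∀ y ∈ S, ∃ A ∈ PP, y ∈ A) ∧ ∀ A ∈ PP, A ⊆ (S : Set P) := by
  classical
  induction n generalizing S PP with
  | zero =>
    obtain ⟨hS, rfl⟩ := h
    refine ⟨{{x}}, by simp, by simp, fun y hy => ⟨{x}, rfl, ?_⟩, ?_⟩
    · rwa [← SetLike.mem_coe, hS] at hy
    · rintro A rfl; rw [hS]
  | succ n ih =>
    obtain ⟨F, v, PPneg, PPpos, hF, hFs, hvS, hvF, hneg, hpos, rfl⟩ := h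
    have hmem : ∀ y, y ∈ F ↔ y ∈ S ∧ l 0 y = l 0 x := fun y => by
      rw [← SetLike.mem_coe, hFs, mem_ofPred_eq]
    have hxF : x ∈ F := (hmem x).2 ⟨hx, rfl⟩
    have hv0 : (l 0).linear v ≠ 0 := fun h0 =>
      hvF ((mem_direction_levelSet_iff hx hFs).2 ⟨hvS, h0⟩)
    obtain ⟨s, rfl, hs, hscov, hssub⟩ := ih hxF hneg
    obtain ⟨t, rfl, ht, htcov, htsub⟩ := ih hxF hpos
    refine ⟨s.image (fun A => addRay (Iic 0) A v) ∪ t.image (fun A => addRay (Ici 0) A v),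
      ?_, ?_, fun y hy => ?_, ?_⟩
    · ext B; simp [glueAlong, eq_comm]
    · calc _ ≤ _ := Finset.card_union_le _ _
        _ ≤ 2 ^ n + 2 ^ n :=
          add_le_add (Finset.card_image_le.trans hs) (Finset.card_image_le.trans ht)
        _ = 2 ^ (n + 1) := by ring
    · set c := (l 0 y - l 0 x) / (l 0).linear v with hc
      have hz : (-c) • v +ᵥ y ∈ F := by
        refine (hmem _).2 ⟨AffineSubspace.vadd_mem_of_mem_direction
          (Submodule.smul_mem _ _ hvS) hy, ?_⟩
        simp [AffineMap.map_vadd, hc, div_mul_cancel₀ _ hv0]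
      have hyz : y = c • v +ᵥ ((-c) • v +ᵥ y) := by simp [vadd_vadd]
      rcases le_total c 0 with h0 | h0
      · obtain ⟨A, hA, hzA⟩ := hscov _ hz
        exact ⟨_, Or.inl ⟨A, hA, rfl⟩, _, hzA, c, h0, hyz⟩
      · obtain ⟨A, hA, hzA⟩ := htcov _ hz
        exact ⟨_, Or.inr ⟨A, hA, rfl⟩, _, hzA, c, h0, hyz⟩
    · rintro B (⟨A, hA, rfl⟩ | ⟨A, hA, rfl⟩) y ⟨a, ha, r, -, rfl⟩
      · exact AffineSubspace.vadd_mem_of_mem_direction (Submodule.smul_mem _ _ hvS)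
          (hF.le (hssub A hA ha))
      · exact AffineSubspace.vadd_mem_of_mem_direction (Submodule.smul_mem _ _ hvS)
          (hF.le (htsub A hA ha))

/-- The map `π` followed by the projection along `v` onto the level set of `f` through `x`
(for `f.linear v ≠ 0`). -/
noncomputable def projAlong (π : P →ᵃ[ℝ] P) (f : P →ᵃ[ℝ] ℝ) (x : P) (v : V) : P →ᵃ[ℝ] P :=
  (LinearMap.toSpanSingleton ℝ V v).toAffineMap.comp
    ((-(f.linear v)⁻¹) • (f.comp π - AffineMap.const ℝ P (f x))) +ᵥ π

section Projection

variable {π : P →ᵃ[ℝ] P} {f g : P →ᵃ[ℝ] ℝ} {x : P} {v : V}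

theorem projAlong_apply (y : P) :
    projAlong π f x v y = (-((f (π y) - f x) / f.linear v)) • v +ᵥ π y := by
  simp [projAlong, div_eq_inv_mul]

theorem form_projAlong (y : P) :
    g (projAlong π f x v y) = g (π y) - (f (π y) - f x) / f.linear v * g.linear v := by
  rw [projAlong_apply, AffineMap.map_vadd]
  simp; ring

theorem preimage_addRay (hv : f.linear v ≠ 0) {A : Set P} (hA : ∀ y ∈ A, f y = f x) (I : Set ℝ) :
    π ⁻¹' addRay I A v = {y | (f (π y) - f x) / f.linear v ∈ I} ∩ projAlong π f x v ⁻¹' A := by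
  ext y
  constructor
  · rintro ⟨a, ha, t, ht, hy⟩
    have h1 : (f (π y) - f x) / f.linear v = t := by
      rw [hy, AffineMap.map_vadd, hA a ha]; simp [hv]
    have h2 : projAlong π f x v y = a := by
      rw [projAlong_apply, h1, hy]; simp [vadd_vadd]
    exact ⟨by simpa [h1] using ht, by simpa [h2] using ha⟩
  · rintro ⟨h1, h2⟩
    refine ⟨_, h2, _, h1, ?_⟩
    rw [projAlong_apply]; simp [vadd_vadd]

end Projection

/-- A set which is covered by at most `2 ^ n` pieces of measure at most `2⁻ⁿ m` has measure at most
`m`. -/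
theorem measure_le_of_forall_cell {Ω : Type*} [MeasurableSpace Ω] {μ : Measure Ω} {n : ℕ}
    {U : Set Ω} {π : Ω → Ω} {s : Finset (Set Ω)}
    (hs : s.card ≤ 2 ^ n) (hcov : ∀ y, ∃ A ∈ s, π y ∈ A) {m : ENNReal}
    (hm : ∀ A ∈ s, μ (U ∩ π ⁻¹' A) ≤ ((2 : ENNReal) ^ n)⁻¹ * m) : μ U ≤ m :=
  calc μ U ≤ μ (⋃ A ∈ s, U ∩ π ⁻¹' A) := by
        refine measure_mono fun y hy => ?_
        obtain ⟨A, hA, hyA⟩ := hcov y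
        exact mem_biUnion (Finset.mem_coe.2 hA) ⟨hy, hyA⟩
    _ ≤ ∑ A ∈ s, μ (U ∩ π ⁻¹' A) := measure_biUnion_finset_le _ _
    _ ≤ s.card • (((2 : ENNReal) ^ n)⁻¹ * m) := Finset.sum_le_card_nsmul _ _ _ hm
    _ ≤ (2 : ENNReal) ^ n * (((2 : ENNReal) ^ n)⁻¹ * m) := by
        rw [nsmul_eq_mul]
        gcongr
        exact_mod_cast hs
    _ = m := by
        rw [← mul_assoc, ENNReal.mul_inv_cancel (by simp) (by simp), one_mul]

variable [FiniteDimensional ℝ V] [MeasurableSpace P] {μ : Measure P}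

section Cells

variable {π : P →ᵃ[ℝ] P} {f : P →ᵃ[ℝ] ℝ} {x : P} {v : V} (U : Set P)

theorem measure_addRay_nonneg (hμ : MemM μ)
    (hf : (f.comp π - AffineMap.const ℝ P (f x)).linear ≠ 0) (hv : 0 < f.linear v)
    {A : Set P} (hA : ∀ y ∈ A, f y = f x) :
    μ (U ∩ π ⁻¹' addRay (Ici 0) A v) =
      μ (U ∩ {y | 0 < (f.comp π - AffineMap.const ℝ P (f x)) y} ∩ projAlong π f x v ⁻¹' A) := by
  rw [preimage_addRay hv.ne' hA, ← inter_assoc]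
  refine measure_congr ?_
  filter_upwards [ae_ne_zero hμ hf] with y hy
  refine propext (and_congr_left fun _ => and_congr_right fun _ => ?_)
  simp only [AffineMap.coe_sub, AffineMap.coe_comp, AffineMap.coe_const, Pi.sub_apply,
    Function.comp_apply, Function.const_apply] at hy
  have h1 : 0 ≤ (f (π y) - f x) / f.linear v ↔ 0 < f (π y) - f x := by
    rw [le_div_iff₀ hv, zero_mul]
    exact ⟨fun h => lt_of_le_of_ne h hy.symm, le_of_lt⟩
  exact h1

theorem measure_addRay_nonpos (hμ : MemM μ)
    (hf : (f.comp π - AffineMap.const ℝ P (f x)).linear ≠ 0) (hv : 0 < f.linear v)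
    {A : Set P} (hA : ∀ y ∈ A, f y = f x) :
    μ (U ∩ π ⁻¹' addRay (Iic 0) A v) =
      μ (U ∩ {y | (f.comp π - AffineMap.const ℝ P (f x)) y < 0} ∩ projAlong π f x v ⁻¹' A) := by
  rw [preimage_addRay hv.ne' hA, ← inter_assoc]
  refine measure_congr ?_
  filter_upwards [ae_ne_zero hμ hf] with y hy
  refine propext (and_congr_left fun _ => and_congr_right fun _ => ?_)
  simp only [AffineMap.coe_sub, AffineMap.coe_comp, AffineMap.coe_const, Pi.sub_apply,
    Function.comp_apply, Function.const_apply] at hy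
  have h1 : (f (π y) - f x) / f.linear v ≤ 0 ↔ f (π y) - f x < 0 := by
    rw [div_le_iff₀ hv, zero_mul]
    exact ⟨fun h => lt_of_le_of_ne h hy, le_of_lt⟩
  exact h1

end Cells

variable [BorelSpace P]

theorem measure_neg_add_measure_pos (hμ : MemM μ) {h : P →ᵃ[ℝ] ℝ} (hh : h.linear ≠ 0)
    (U : Set P) : μ (U ∩ {x | h x < 0}) + μ (U ∩ {x | 0 < h x}) = μ U := by
  rw [← measure_inter_add_sdiff U (measurableSet_neg h)]
  congr 1
  refine measure_congr ?_
  filter_upwards [ae_ne_zero hμ hh] with x hx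
  refine propext (and_congr_right fun _ => ?_)
  have h1 : 0 < h x ↔ ¬ h x < 0 :=
    ⟨not_lt_of_gt, fun h => lt_of_le_of_ne (not_lt.1 h) hx.symm⟩
  exact h1

theorem measure_pos_eq_half (hμ : MemM μ) {h : P →ᵃ[ℝ] ℝ} (hh : h.linear ≠ 0) {U : Set P}
    (hU : μ (U ∩ {x | h x < 0}) = μ (U ∩ {x | 0 < h x})) : μ (U ∩ {x | 0 < h x}) = μ U / 2 := by
  have h1 := measure_neg_add_measure_pos hμ hh U
  rw [hU, ← mul_two] at h1
  rw [← h1, ENNReal.mul_div_cancel_right (by simp) (by simp)]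

/-! ### Partitions and trees -/

/-- The translation between partitions and trees: instead of projecting the measure onto smaller
and smaller subspaces, the coordinates are pulled back to the whole space along the projection `π`
onto `S`. -/
theorem exists_adapted_iff_exists_isTree (hμ : MemM μ) {n : ℕ} {l : Fin n → (P →ᵃ[ℝ] ℝ)}
    {S : AffineSubspace ℝ P} (hl : IsCoordinateSystemOn l S) {x : P} (hx : x ∈ S)
    {π : P →ᵃ[ℝ] P} (hπS : ∀ y, π y ∈ S) (hπ : ∀ y ∈ S, π y = y) {U : Set P} :
    (∃ PP, IsAdaptedYaoYaoPartition n l S PP x ∧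
      ∀ A ∈ PP, μ (U ∩ π ⁻¹' A) = ((2 : ENNReal) ^ n)⁻¹ * μ U) ↔
    ∃ T, IsTree μ n U (fun i => (l i).comp π - AffineMap.const ℝ P (l i x)) T := by
  have := hμ.isFiniteMeasure
  induction n generalizing S π U with
  | zero =>
    refine ⟨fun _ => ⟨_, rfl⟩, fun _ => ⟨{{x}}, ⟨?_, rfl⟩, ?_⟩⟩
    · refine eq_singleton_iff_unique_mem.2 ⟨hx, fun y hy => ?_⟩
      obtain ⟨v, -, hv⟩ := hl Fin.elim0
      have h1 := hv (y -ᵥ x) ⟨AffineSubspace.vsub_mem_direction hy hx, fun i => i.elim0⟩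
      have h2 := hv 0 ⟨Submodule.zero_mem _, fun i => i.elim0⟩
      rw [← vsub_eq_zero_iff_eq, h1, h2]
    · rintro A rfl
      have : π ⁻¹' {x} = univ := by
        refine eq_univ_of_forall fun y => ?_
        obtain ⟨v, -, hv⟩ := hl Fin.elim0
        have h1 := hv (π y -ᵥ x) ⟨AffineSubspace.vsub_mem_direction (hπS y) hx, fun i => i.elim0⟩
        have h2 := hv 0 ⟨Submodule.zero_mem _, fun i => i.elim0⟩
        rw [mem_preimage, mem_singleton_iff, ← vsub_eq_zero_iff_eq, h1, h2]
      simp [this]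
  | succ n ih =>
    obtain ⟨F, hF⟩ := exists_levelSet S (l 0) x
    have hmem : ∀ y, y ∈ F ↔ y ∈ S ∧ l 0 y = l 0 x := fun y => by
      rw [← SetLike.mem_coe, hF, mem_ofPred_eq]
    have hxF : x ∈ F := (hmem x).2 ⟨hx, rfl⟩
    have hlin : ((l 0).comp π - AffineMap.const ℝ P (l 0 x)).linear ≠ 0 := by
      obtain ⟨v, ⟨hv, hv1⟩, -⟩ := hl (Fin.cons 1 0)
      intro h0
      have h1 : (l 0).linear (π.linear v) = 0 := by
        simpa using congrArg (fun g : V →ₗ[ℝ] ℝ => g v) h0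
      have h2 : π.linear v = v := by
        have := π.map_vadd x v
        rw [hπ x hx, hπ _ (AffineSubspace.vadd_mem_of_mem_direction hv hx)] at this
        exact (vadd_right_cancel x this).symm
      have h3 : (l 0).linear v = 1 := by simpa using hv1 0
      rw [h2, h3] at h1
      exact one_ne_zero h1
    -- The recursion hypothesis, for the projection along a vector transversal to `F`.
    have key : ∀ v ∈ S.direction, 0 < (l 0).linear v → ∀ W : Set P,
        ((∃ PP, IsAdaptedYaoYaoPartition n (fun i => l i.succ) F PP x ∧
          ∀ A ∈ PP, μ (W ∩ projAlong π (l 0) x v ⁻¹' A) = ((2 : ENNReal) ^ n)⁻¹ * μ W) ↔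
        ∃ T, IsTree μ n W (fun i => ((l i.succ).comp π - AffineMap.const ℝ P (l i.succ x)) -
          ((l i.succ).linear v / (l 0).linear v) •
            ((l 0).comp π - AffineMap.const ℝ P (l 0 x))) T) := by
      intro v hv hv0 W
      have hX : (fun i : Fin n => ((l i.succ).comp π - AffineMap.const ℝ P (l i.succ x)) -
          ((l i.succ).linear v / (l 0).linear v) •
            ((l 0).comp π - AffineMap.const ℝ P (l 0 x))) =
          fun i : Fin n => (l i.succ).comp (projAlong π (l 0) x v) -
            AffineMap.const ℝ P (l i.succ x) := by
        funext i
        ext y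
        simp [form_projAlong]
        ring
      rw [hX]
      refine ih (hl.tail hx hF) hxF (fun y => (hmem _).2 ⟨?_, ?_⟩) (fun y hy => ?_)
      · rw [projAlong_apply]
        exact AffineSubspace.vadd_mem_of_mem_direction (Submodule.smul_mem _ _ hv) (hπS y)
      · rw [form_projAlong, div_mul_cancel₀ _ hv0.ne']; ring
      · rw [hmem] at hy
        rw [projAlong_apply, hπ y hy.1, hy.2]; simp
    have hhalf : ((2 : ENNReal) ^ (n + 1))⁻¹ * μ U = ((2 : ENNReal) ^ n)⁻¹ * (μ U / 2) := by
      rw [pow_succ, ENNReal.mul_inv (by simp) (by simp), mul_assoc, div_eq_mul_inv,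
        mul_comm (μ U)]
    constructor
    · rintro ⟨PP, ⟨F', v, PPneg, PPpos, -, hF', hvS, hvF, hneg, hpos, rfl⟩, hPP⟩
      obtain rfl : F' = F := SetLike.coe_injective (hF'.trans hF.symm)
      wlog hv0 : 0 < (l 0).linear v generalizing v PPneg PPpos
      · refine this (-v) PPpos PPneg (by simpa using hvS) (by simpa using hvF) hpos hneg
          (by rwa [glueAlong_neg]) ?_
        have : (l 0).linear v ≠ 0 := fun h0 =>
          hvF ((mem_direction_levelSet_iff hx hF).2 ⟨hvS, h0⟩)
        simpa using lt_of_le_of_ne (not_lt.1 hv0) this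
      obtain ⟨s, rfl, hs, hscov, hssub⟩ := hneg.exists_finset hxF
      obtain ⟨t, rfl, ht, htcov, htsub⟩ := hpos.exists_finset hxF
      have hproj : ∀ y, projAlong π (l 0) x v y ∈ F' := fun y => by
        refine (hmem _).2 ⟨?_, ?_⟩
        · rw [projAlong_apply]
          exact AffineSubspace.vadd_mem_of_mem_direction (Submodule.smul_mem _ _ hvS) (hπS y)
        · rw [form_projAlong, div_mul_cancel₀ _ hv0.ne']; ring
      have hneg' := fun A hA => (measure_addRay_nonpos U hμ hlin hv0
        fun y hy => ((hmem y).1 (hssub A hA hy)).2).symm.trans (hPP _ (Or.inl ⟨A, hA, rfl⟩))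
      have hpos' := fun A hA => (measure_addRay_nonneg U hμ hlin hv0
        fun y hy => ((hmem y).1 (htsub A hA hy)).2).symm.trans (hPP _ (Or.inr ⟨A, hA, rfl⟩))
      rw [hhalf] at hneg' hpos'
      -- The cells on each side cover it, so neither side has more than half of the mass.
      have h1 := measure_le_of_forall_cell hs (fun y => hscov _ (hproj y))
        fun A hA => (hneg' A hA).le
      have h2 := measure_le_of_forall_cell ht (fun y => htcov _ (hproj y))
        fun A hA => (hpos' A hA).le
      have h3 := measure_neg_add_measure_pos hμ hlin U
      have h4 := ENNReal.add_halves (μ U)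
      have hfin : μ U / 2 ≠ ⊤ := ENNReal.div_ne_top (measure_ne_top μ U) two_ne_zero
      have h5 : μ (U ∩ {y | ((l 0).comp π - AffineMap.const ℝ P (l 0 x)) y < 0}) = μ U / 2 := by
        refine h1.antisymm (not_lt.1 fun hlt => ?_)
        have := ENNReal.add_lt_add_of_lt_of_le (ne_top_of_le_ne_top hfin h2) hlt h2
        rw [h3, h4] at this
        exact lt_irrefl _ this
      have h6 : μ (U ∩ {y | 0 < ((l 0).comp π - AffineMap.const ℝ P (l 0 x)) y}) = μ U / 2 := by
        rw [h5] at h3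
        exact (ENNReal.add_right_inj hfin).1 (h3.trans h4.symm)
      obtain ⟨A, hA⟩ := (key v hvS hv0 _).1 ⟨_, hpos, fun A hA => by rw [hpos' A hA, h6]⟩
      obtain ⟨B, hB⟩ := (key v hvS hv0 _).1 ⟨_, hneg, fun A hA => by rw [hneg' A hA, h5]⟩
      exact ⟨_, h5.trans h6.symm, _, A, B, rfl, hA, hB⟩
    · rintro ⟨_, hbal, w, A, B, rfl, hA, hB⟩
      have hp := measure_pos_eq_half hμ hlin hbal
      have hn := hbal.trans hp
      obtain ⟨v, ⟨hv, hvw⟩, -⟩ := hl (Fin.cons 1 w)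
      have hv1 : (l 0).linear v = 1 := by simpa using hvw 0
      have hvi : ∀ i : Fin n, (l i.succ).linear v = w i := fun i => by simpa using hvw i.succ
      have hv0 : 0 < (l 0).linear v := hv1 ▸ one_pos
      have hvF : v ∉ F.direction := fun h => by
        rw [mem_direction_levelSet_iff hx hF] at h
        exact hv0.ne' h.2
      obtain ⟨PPpos, hpos, hpos'⟩ := (key v hv hv0 _).2
        ⟨A, by simpa only [hv1, hvi, div_one] using hA⟩
      obtain ⟨PPneg, hneg, hneg'⟩ := (key v hv hv0 _).2
        ⟨B, by simpa only [hv1, hvi, div_one] using hB⟩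
      obtain ⟨-, -, -, -, hssub⟩ := hneg.exists_finset hxF
      obtain ⟨-, -, -, -, htsub⟩ := hpos.exists_finset hxF
      refine ⟨_, ⟨F, v, PPneg, PPpos, hl.isAffineHyperplane hx hF, hF, hv, hvF, hneg, hpos, rfl⟩,
        ?_⟩
      rintro _ (⟨C, hC, rfl⟩ | ⟨C, hC, rfl⟩)
      · rw [measure_addRay_nonpos U hμ hlin hv0 fun y hy => ((hmem y).1 (hssub C hC hy)).2,
          hneg' C hC, hhalf]
        congr 1
      · rw [measure_addRay_nonneg U hμ hlin hv0 fun y hy => ((hmem y).1 (htsub C hC hy)).2,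
          hpos' C hC, hhalf]
        congr 1

theorem isYaoYaoCenter_iff (hμ : MemM μ) {n : ℕ} {l : Fin n → (P →ᵃ[ℝ] ℝ)}
    (hl : IsCoordinateSystem l) (x : P) :
    IsYaoYaoCenter l μ x ↔
      ∃ T, IsTree μ n univ (fun i => l i - AffineMap.const ℝ P (l i x)) T := by
  have h := exists_adapted_iff_exists_isTree hμ hl.isCoordinateSystemOn_top
    (AffineSubspace.mem_top ℝ V x) (π := AffineMap.id ℝ P)
    (fun y => AffineSubspace.mem_top ℝ V y) (fun _ _ => rfl) (U := univ)
  simp only [AffineMap.comp_id] at h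
  rw [← h]
  refine exists_congr fun PP => and_congr_right fun hPP =>
    ⟨fun h A hA => ?_, fun h => ⟨hPP.isYaoYaoPartition, fun A hA => ?_⟩⟩
  · simpa [hl.1] using h.measure_eq A hA
  · simpa [hl.1] using h A hA

end YaoYaoGeometry

/-- Every measure in `M*(E)` has exactly one center with respect to a given system of
coordinates. -/
theorem mainTheorem2 {V P : Type*} [NormedAddCommGroup V] [NormedSpace ℝ V]
    [FiniteDimensional ℝ V] [MetricSpace P] [NormedAddTorsor V P]
    [MeasurableSpace P] [BorelSpace P]
    {n : ℕ} (l : Fin n → (P →ᵃ[ℝ] ℝ)) (hl : IsCoordinateSystem l)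
    (μ : Measure P) (hμ : MemMStar μ) :
    ∃! x : P, IsYaoYaoCenter l μ x := by
  have hsurj : ∀ w : Fin n → ℝ, ∃ v : V, ∀ i, (l i).linear v = w i := fun w =>
    let ⟨v, hv, _⟩ := hl.isCoordinateSystemOn_top w
    ⟨v, hv.2⟩
  obtain ⟨c, T, -, hT, huniq⟩ := SplitTree.exists_unique_isTree hμ l hsurj
  have x₀ := Classical.arbitrary P
  obtain ⟨v, hv⟩ := hsurj fun i => c i - l i x₀
  have hx : ∀ i, l i (v +ᵥ x₀) = c i := fun i => by simp [AffineMap.map_vadd, hv]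
  refine ⟨v +ᵥ x₀, (isYaoYaoCenter_iff hμ.toMemM hl _).2 ⟨T, by simpa only [hx] using hT⟩,
    fun y hy => hl.2 (funext fun i => ?_)⟩
  obtain ⟨T', hT'⟩ := (isYaoYaoCenter_iff hμ.toMemM hl _).1 hy
  exact (congrFun (huniq _ T' hT').1 i).trans (hx i).symm
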